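/- Let $n\in\mathbb{N}$ and let $K\subset\mathbb{R}^n$ be compact and path-connected. For a linear space $\mathcal V$ of real functions on $K$, a linear functional $L:\mathcal V\to\mathbb R$ is a $K$-moment functional if it has a representing measure, i.e. a (non-negative) Borel measure $\mu$ on $K$ such that every $v\in\mathcal V$ is $\mu$-integrable and $L(v)=\int_K v\,\mathrm d\mu$; likewise a linear functional $T:\mathbb R[t]\to\mathbb R$ is a $[0,1]$-moment functional (Hausdorff moment functional) if there is a representing Borel measure $\tilde\mu$ on $[0,1]$, i.e. $T(p)=\int_0^1 p\,\mathrm d\tilde\mu$ for all $p\in\mathbb R[t]$ (with $p$ $\tilde\mu$-integrable). For $g:K\to[0,1]$ put $\mathbb R[g]=\{p\circ g: p\in\mathbb R[t]\}$. A linear functional $\overline L:\mathcal V+\mathbb R[g]\to\mathbb R$ is called a continuous extension of $L$ if $\overline L|_{\mathcal V}=L$ and, whenever $p_i\in\mathbb R[t]$ converge uniformly on $[0,1]$ to some $p\in C([0,1],\mathbb R)$ with $p\circ g\in\mathcal V$, then $\overline L(p_i\circ g)\to L(p\circ g)$. For such $\overline L$ let $\tilde L:\mathbb R[t]\to\mathbb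 R$ be the linear functional with $\tilde L(t^d)=\overline L(g^d)$ for all $d\in\mathbb N_0$. Then there exists a Borel measurable function $g:K\to[0,1]$ with the following properties. (a) For every linear space $\mathcal V$ with $1\in\mathcal V\subseteq C(K,\mathbb R)$ and every linear functional $L:\mathcal V\to\mathbb R$ the following are equivalent: (i) $L$ is a $K$-moment functional; (ii) $L$ has a continuous extension $\overline L:\mathcal V+\mathbb R[g]\to\mathbb R$ such that $\tilde L$ is a $[0,1]$-moment functional. Moreover, for every representing measure $\mu$ of $L$ there is a continuous extension $\overline L$ of $L$ for which $\mu\circ g^{-1}$ is a representing measure of $\tilde L$. (b) If, in addition, $K$ is locally connected, then there is a continuous surjective function $f:[0,1]\to K$ (independent of $\mathcal V$, $L$, $\overline L$ and $\tilde L$) such that $f(g(x))=x$ for all $x\in K$ and such that, for all $\mathcal V$ and $L$ as in (a) and every continuous extension $\overline L$ of $L$, if $\tilde\mu$ is a representing measure of $\tilde L$, then $\tilde\mu\circ f^{-1}$ is a representing measure of $L$. -/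

import Mathlib

open MeasureTheory Filter Topology
open scoped Polynomial unitInterval

noncomputable section

namespace MomentTransform

/-- `μ` is a representing measure of the linear functional `L` on the space `V` of real functions
on `X`: every `v ∈ V` is `μ`-integrable and `L v = ∫ v dμ`. -/
def Represents {X : Type*} [MeasurableSpace X] {V : Submodule ℝ (X → ℝ)}
    (μ : Measure X) (L : V →ₗ[ℝ] ℝ) : Prop :=
  ∀ v : V, Integrable (v : X → ℝ) μ ∧ L v = ∫ x, (v : X → ℝ) x ∂μ

/-- `L` is a moment functional: it is represented by some (non-negative) measure on `X`. -/
def IsMomentFunctional {X : Type*} [MeasurableSpace X] {V : Submodule ℝ (X → ℝ)}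
    (L : V →ₗ[ℝ] ℝ) : Prop :=
  ∃ μ : Measure X, Represents μ L

/-- `μ` is a representing measure on `[0,1]` of the linear functional `T` on `ℝ[t]`. -/
def HausdorffRepresents (μ : Measure I) (T : ℝ[X] →ₗ[ℝ] ℝ) : Prop :=
  ∀ p : ℝ[X], Integrable (fun t : I => p.eval (t : ℝ)) μ ∧ T p = ∫ t : I, p.eval (t : ℝ) ∂μ

/-- `T` is a `[0,1]`-moment functional (Hausdorff moment functional) on `ℝ[t]`. -/
def IsHausdorffMomentFunctional (T : ℝ[X] →ₗ[ℝ] ℝ) : Prop :=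
  ∃ μ : Measure I, HausdorffRepresents μ T

/-- The linear map `p ↦ p ∘ g` from `ℝ[t]` to real functions on `X`, for `g : X → [0,1]`. -/
def polyComp {X : Type*} (g : X → I) : ℝ[X] →ₗ[ℝ] (X → ℝ) where
  toFun p := fun x => p.eval (g x : ℝ)
  map_add' p q := by ext x; simp
  map_smul' c p := by ext x; simp

/-- The space `ℝ[g]` of all polynomials in `g`. -/
def polySpace {X : Type*} (g : X → I) : Submodule ℝ (X → ℝ) :=
  LinearMap.range (polyComp g)

/-- The linear map `p ↦ p ∘ g` with values in `V + ℝ[g]`. -/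
def polyCompSup {X : Type*} (V : Submodule ℝ (X → ℝ)) (g : X → I) :
    ℝ[X] →ₗ[ℝ] ↥(V ⊔ polySpace g) :=
  (polyComp g).codRestrict (V ⊔ polySpace g) fun p =>
    Submodule.mem_sup_right (LinearMap.mem_range_self (polyComp g) p)

/-- The linear functional on `ℝ[t]` with `t ^ d ↦ Lbar (g ^ d)`, that is `p ↦ Lbar (p ∘ g)`. -/
def pullback {X : Type*} {V : Submodule ℝ (X → ℝ)} {g : X → I}
    (Lbar : ↥(V ⊔ polySpace g) →ₗ[ℝ] ℝ) : ℝ[X] →ₗ[ℝ] ℝ :=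
  Lbar ∘ₗ polyCompSup V g

/-- `Lbar : V + ℝ[g] → ℝ` continuously extends `L : V → ℝ`: it agrees with `L` on `V`, and
`Lbar (pᵢ ∘ g) → L (p ∘ g)` whenever the polynomials `pᵢ` converge uniformly on `[0,1]` to a
continuous `p` with `p ∘ g ∈ V`. -/
structure IsContinuousExtension {X : Type*} {V : Submodule ℝ (X → ℝ)} (g : X → I)
    (L : V →ₗ[ℝ] ℝ) (Lbar : ↥(V ⊔ polySpace g) →ₗ[ℝ] ℝ) : Prop where
  extends_eq : ∀ v : V, Lbar (Submodule.inclusion le_sup_left v) = L v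
  tendsto : ∀ (p : ℕ → ℝ[X]) (q : C(I, ℝ)) (hq : (fun x => q (g x)) ∈ V),
    TendstoUniformly (fun i (t : I) => (p i).eval (t : ℝ)) (fun t => q t) atTop →
      Tendsto (fun i => Lbar (polyCompSup V g (p i))) atTop (𝓝 (L ⟨fun x => q (g x), hq⟩))

end MomentTransform

end

/-! Let `φ` be a continuous surjection onto `K` from a closed `C ⊆ [0,1]`, and let `g` be a Borel
section of it. Every `v ∈ V` equals `(v ∘ φ) ∘ g`, and `v ∘ φ` extends to some `q ∈ C([0,1])` by
Tietze. Approximating `q` by polynomials, the continuity of `Lbar` forces `L v = ∫ q dμ̃`. Since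
`dist(·, C) ∘ g = 0`, the same identity shows that `μ̃` lives on `C`, so its image under `φ`
represents `L`. Conversely, integration against a representing measure `μ` of `L` is itself a
continuous extension: `μ` is finite because `1 ∈ V`, so uniform limits pass through the integral.

If `K` is locally connected, Hahn–Mazurkiewicz allows `C = [0,1]`; otherwise `C` is the Cantor set.
Hahn–Mazurkiewicz is proved with ever finer chains of points, each link of one being replaced by a
short tour in the next, so that the associated step functions on `[0,1]` converge uniformly. -/

/-! ### Hahn–Mazurkiewicz by refinement of chains. -/

section Chains

variable {X : Type*} [MetricSpace X]

/-- There is an `η`-chain inside `A` from `x` to `y`, written as an eventually constant sequence,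
which visits all points of `F`. -/
def HasTour (A : Set X) (η : ℝ) (F : Set X) (x y : X) : Prop :=
  ∃ (m : ℕ) (b : ℕ → X), b 0 = x ∧ (∀ j, m ≤ j → b j = y) ∧ (∀ j, b j ∈ A) ∧
    (∀ j, dist (b j) (b (j + 1)) < η) ∧ ∀ z ∈ F, ∃ j, b j = z

theorem HasTour.trans {A : Set X} {η : ℝ} {F G : Set X} {x y z : X}
    (h₁ : HasTour A η F x y) (h₂ : HasTour A η G y z) : HasTour A η (F ∪ G) x z := by
  obtain ⟨m, b, hb0, hbm, hbA, hbd, hbF⟩ := h₁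
  obtain ⟨m', b', hb0', hbm', hbA', hbd', hbF'⟩ := h₂
  have key : ∀ j, j ≤ m → (if j < m then b j else b' (j - m)) = b j := by
    intro j hj
    split_ifs with h
    · rfl
    · obtain rfl : j = m := by omega
      rw [Nat.sub_self, hb0', hbm j le_rfl]
  refine ⟨m + m', fun j => if j < m then b j else b' (j - m), ?_, ?_, ?_, ?_, ?_⟩
  · exact (key 0 (Nat.zero_le m)).trans hb0
  · intro j hj
    simp only [if_neg (show ¬ j < m by omega)]
    exact hbm' _ (by omega)
  · intro j
    dsimp only
    split_ifs
    exacts [hbA j, hbA' _]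
  · intro j
    dsimp only
    by_cases h : j < m
    · rw [key j h.le, key (j + 1) h]
      exact hbd j
    · rw [if_neg h, if_neg (by omega), Nat.sub_add_comm (by omega)]
      exact hbd' _
  · rintro w (hw | hw)
    · obtain ⟨j, rfl⟩ := hbF w hw
      refine ⟨min j m, ?_⟩
      simp only [key _ (min_le_right j m)]
      rcases le_total j m with h | h
      · rw [min_eq_left h]
      · rw [min_eq_right h, hbm m le_rfl, hbm j h]
    · obtain ⟨j, rfl⟩ := hbF' w hw
      exact ⟨m + j, by simp⟩

theorem HasTour.of_dist_lt {A : Set X} {η : ℝ} {x y : X} (hη : 0 < η) (hx : x ∈ A) (hy : y ∈ A)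
    (h : dist x y < η) : HasTour A η ∅ x y := by
  refine ⟨1, fun j => if j = 0 then x else y, by simp, ?_, ?_, ?_, by simp⟩
  · intro j hj
    simp [show j ≠ 0 by omega]
  · intro j
    dsimp only
    split_ifs <;> assumption
  · intro j
    by_cases hj : j = 0 <;> simp [hj, h, hη]

/-- Being joined by a chain is transitive and holds between nearby points, so it cannot separate a
preconnected set. -/
theorem HasTour.of_isPreconnected {A : Set X} (hA : IsPreconnected A) {η : ℝ} (hη : 0 < η)
    {x y : X} (hx : x ∈ A) (hy : y ∈ A) : HasTour A η ∅ x y := by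
  refine hA.induction₂' (fun a b => HasTour A η ∅ a b) (fun a ha => ?_) ?_ hx hy
  · filter_upwards [self_mem_nhdsWithin, mem_nhdsWithin_of_mem_nhds (Metric.ball_mem_nhds a hη)]
      with b hb hab
    exact ⟨.of_dist_lt hη ha hb (by rwa [dist_comm]), .of_dist_lt hη hb ha hab⟩
  · intro a b c _ _ _ hab hbc
    simpa using hab.trans hbc

theorem HasTour.of_finite {A : Set X} (hA : IsPreconnected A) {η : ℝ} (hη : 0 < η)
    {F : Set X} (hF : F.Finite) (hFA : F ⊆ A) {x y : X} (hx : x ∈ A) (hy : y ∈ A) :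
    HasTour A η F x y := by
  induction F, hF using Set.Finite.induction_on generalizing x with
  | empty => exact .of_isPreconnected hA hη hx hy
  | @insert a s _ _ ih =>
    have ha : a ∈ A := hFA (Set.mem_insert _ _)
    obtain ⟨m, b, hb0, hbm, hbA, hbd, hbF⟩ := ih (fun z hz => hFA (Set.mem_insert_of_mem _ hz)) ha
    have h : HasTour A η (insert a s) a y :=
      ⟨m, b, hb0, hbm, hbA, hbd, by
        rintro z (rfl | hz)
        exacts [⟨0, hb0⟩, hbF z hz]⟩
    simpa using (HasTour.of_isPreconnected hA hη hx ha).trans h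

/-- `(N, c)` is a `δ`-dense `δ`-chain `c 0, …, c N`. -/
structure IsDenseChain (δ : ℝ) (N : ℕ) (c : ℕ → X) : Prop where
  pos : 0 < N
  dist_lt : ∀ i < N, dist (c i) (c (i + 1)) < δ
  dense : ∀ x, ∃ i < N, dist x (c i) < δ

/-- Every ball of radius `δ` is contained in a connected set contained in the concentric ball of
radius `ε`. -/
def UniformlyConnected (X : Type*) [MetricSpace X] (δ ε : ℝ) : Prop :=
  ∀ x : X, ∃ A : Set X, IsPreconnected A ∧ Metric.ball x δ ⊆ A ∧ A ⊆ Metric.ball x ε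

theorem exists_uniformlyConnected [CompactSpace X] [LocallyConnectedSpace X] {ε : ℝ} (hε : 0 < ε) :
    ∃ δ, 0 < δ ∧ δ ≤ ε ∧ UniformlyConnected X δ ε := by
  have h : ∀ p : X, ∃ U ⊆ Metric.ball p (ε / 2), IsOpen U ∧ p ∈ U ∧ IsConnected U := fun p =>
    locallyConnectedSpace_iff_subsets_isOpen_isConnected.1 inferInstance p _
      (Metric.ball_mem_nhds p (half_pos hε))
  choose U hUb hUo hUp hUc using h
  obtain ⟨δ, hδ, hU⟩ := lebesgue_number_lemma_of_metric (isCompact_univ (X := X)) hUo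
    (fun p _ => Set.mem_iUnion.2 ⟨p, hUp p⟩)
  refine ⟨min δ ε, lt_min hδ hε, min_le_right _ _, fun x => ?_⟩
  obtain ⟨p, hp⟩ := hU x trivial
  refine ⟨U p, (hUc p).isPreconnected,
    (Metric.ball_subset_ball (min_le_left _ _)).trans hp, fun y hy => ?_⟩
  have hx := hUb p (hp (Metric.mem_ball_self hδ))
  have hy := hUb p hy
  rw [Metric.mem_ball] at *
  linarith [dist_triangle_right y x p]

/-- Each link becomes a tour of a finite `η`-net of a small connected set around `c i`. Padding by
repetition gives all tours the same length `M`, so the fine index `j` lies over the coarse index `j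
/ M`. -/
theorem IsDenseChain.exists_refinement [CompactSpace X] {δ ε η : ℝ} (hδε : UniformlyConnected X δ ε)
    (hδ : 0 < δ) (hη : 0 < η) {N : ℕ} {c : ℕ → X} (h : IsDenseChain δ N c) :
    ∃ (M : ℕ) (c' : ℕ → X), 0 < M ∧ IsDenseChain η (N * M) c' ∧
      ∀ j ≤ N * M, dist (c (j / M)) (c' j) < ε := by
  have hblock : ∀ i, ∃ (m : ℕ) (b : ℕ → X), b 0 = c i ∧ (∀ j, dist (b j) (c i) < ε) ∧
      (i < N → (∀ j, m ≤ j → b j = c (i + 1)) ∧ (∀ j, dist (b j) (b (j + 1)) < η) ∧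
        ∀ z, dist z (c i) < δ → ∃ j, dist z (b j) < η) := by
    intro i
    obtain ⟨A, hA, hδA, hAε⟩ := hδε (c i)
    have hci : c i ∈ A := hδA (Metric.mem_ball_self hδ)
    by_cases hi : i < N
    · obtain ⟨F, hFA, hF, hcover⟩ := exists_finite_cover_balls_of_isCompact_closure
        (isClosed_closure (s := A)).isCompact hη
      have hci' : c (i + 1) ∈ A := hδA (by
        rw [Metric.mem_ball, dist_comm]
        exact h.dist_lt i hi)
      obtain ⟨m, b, hb0, hbm, hbA, hbd, hbF⟩ := HasTour.of_finite hA hη hF hFA hci hci'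
      refine ⟨m, b, hb0, fun j => hAε (hbA j), fun _ => ⟨hbm, hbd, fun z hz => ?_⟩⟩
      obtain ⟨w, hw, hzw⟩ := Set.mem_iUnion₂.1 (hcover (hδA hz))
      obtain ⟨j, rfl⟩ := hbF w hw
      exact ⟨j, hzw⟩
    -- Constant blocks past the last link; the endpoint `j = N * M` falls into one.
    · exact ⟨0, fun _ => c i, rfl, fun _ => hAε hci, fun h => absurd h hi⟩
  choose m b hb0 hbε hb using hblock
  set M := (Finset.range N).sup m + 1 with hM
  have hMpos : 0 < M := Nat.succ_pos _
  have hmM : ∀ i < N, m i < M := fun i hi =>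
    Nat.lt_succ_of_le (Finset.le_sup (f := m) (Finset.mem_range.2 hi))
  refine ⟨M, fun j => b (j / M) (j % M), hMpos, ⟨Nat.mul_pos h.pos hMpos, ?_, ?_⟩, ?_⟩
  · intro j hj
    have hi : j / M < N := Nat.div_lt_of_lt_mul (by rwa [mul_comm])
    obtain ⟨hbm, hbd, -⟩ := hb _ hi
    have hdm := Nat.div_add_mod j M
    have hlt := Nat.mod_lt j hMpos
    rcases Nat.lt_or_ge (j % M + 1) M with hlt' | hge
    · have h1 : (j + 1) / M = j / M := by
        rw [Nat.div_eq_iff hMpos]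
        rw [mul_comm]
        omega
      have h2 : (j + 1) % M = j % M + 1 := by
        have := Nat.div_add_mod (j + 1) M
        rw [h1] at this
        omega
      rw [h1, h2]
      exact hbd _
    · have h0 : j + 1 = (j / M + 1) * M := by
        rw [add_mul, one_mul, mul_comm]; omega
      have h1 : (j + 1) / M = j / M + 1 := by rw [h0, Nat.mul_div_cancel _ hMpos]
      have h2 : (j + 1) % M = 0 := by rw [h0, Nat.mul_mod_left]
      -- At the end of a block the tour already rests at `c (i + 1)`, where the next block starts.
      rw [h1, h2, hb0, ← hbm (j % M + 1) ((hmM _ hi).le.trans hge)]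
      exact hbd _
  · intro z
    obtain ⟨i, hi, hz⟩ := h.dense z
    obtain ⟨hbm, -, hbz⟩ := hb i hi
    obtain ⟨j, hj⟩ := hbz z hz
    -- A visit later than `m i` is to the resting point, already reached at time `m i`.
    have hlt : min j (m i) < M := (min_le_right _ _).trans_lt (hmM i hi)
    refine ⟨min j (m i) + i * M, ?_, ?_⟩
    · calc min j (m i) + i * M < M + i * M := by omega
        _ = (i + 1) * M := by ring
        _ ≤ N * M := Nat.mul_le_mul_right _ hi
    · rw [Nat.add_mul_div_right _ _ hMpos, Nat.div_eq_of_lt hlt, Nat.add_mul_mod_self_right,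
        Nat.mod_eq_of_lt hlt, zero_add]
      rcases le_total j (m i) with hjm | hjm
      · rwa [min_eq_left hjm]
      · rwa [min_eq_right hjm, hbm _ le_rfl, ← hbm j hjm]
  · intro j _
    rw [dist_comm]
    exact hbε _ _

theorem exists_seq_isDenseChain [CompactSpace X] [ConnectedSpace X] [LocallyConnectedSpace X] :
    ∃ (D : ℝ) (N : ℕ → ℕ) (M : ℕ → ℕ) (c : ℕ → ℕ → X),
      (∀ k, 0 < M k) ∧ (∀ k, N (k + 1) = N k * M k) ∧
      (∀ k, IsDenseChain (D / 2 ^ k) (N k) (c k)) ∧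
      ∀ k, ∀ j ≤ N (k + 1), dist (c k (j / M k)) (c (k + 1) j) ≤ D / 2 / 2 ^ k := by
  obtain ⟨R, hR⟩ := (Metric.isBounded_iff.1 (isCompact_univ (X := X)).isBounded)
  have hR0 : 0 ≤ R := by
    obtain ⟨x⟩ := (inferInstance : Nonempty X)
    simpa using hR (Set.mem_univ x) (Set.mem_univ x)
  set D := R + 1
  have hD : 0 < D := by positivity
  have hpos : ∀ k : ℕ, 0 < D / 2 / 2 ^ k := fun k => by positivity
  choose δ hδ0 hδε hδ using fun k => exists_uniformlyConnected (X := X) (hpos k)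
  let S : ℕ → Type _ := fun k => {s : ℕ × (ℕ → X) // IsDenseChain (δ k) s.1 s.2}
  have hstart : Nonempty (S 0) := by
    obtain ⟨x₀⟩ := (inferInstance : Nonempty X)
    have hball : ∀ x y : X, dist x y < D := fun x y =>
      (hR (Set.mem_univ x) (Set.mem_univ y)).trans_lt (lt_add_one R)
    -- `D` exceeds the diameter, so a single repeated point is a valid coarse chain.
    have hc : IsDenseChain D 1 (fun _ => x₀) :=
      ⟨one_pos, fun _ _ => hball _ _, fun x => ⟨0, one_pos, hball _ _⟩⟩
    have hu : UniformlyConnected X D D := fun x =>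
      ⟨Set.univ, isPreconnected_univ, Set.subset_univ _, fun y _ => hball y x⟩
    obtain ⟨M, c', -, hc', -⟩ := hc.exists_refinement hu hD (hδ0 0)
    exact ⟨⟨(1 * M, c'), hc'⟩⟩
  have hstep : ∀ k (s : S k), ∃ (t : S (k + 1)) (M : ℕ), 0 < M ∧ t.1.1 = s.1.1 * M ∧
      ∀ j ≤ t.1.1, dist (s.1.2 (j / M)) (t.1.2 j) ≤ D / 2 / 2 ^ k := by
    intro k s
    obtain ⟨M, c', hM, hc', hd⟩ := s.2.exists_refinement (hδ k) (hδ0 k) (hδ0 (k + 1))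
    exact ⟨⟨(_, c'), hc'⟩, M, hM, rfl, fun j hj => (hd j hj).le⟩
  choose next M hM hN hd using hstep
  let s : ∀ k, S k := fun k => Nat.rec hstart.some (fun k t => next k t) k
  refine ⟨D, fun k => (s k).1.1, fun k => M k (s k), fun k => (s k).1.2, fun k => hM k _,
    fun k => hN k (s k), fun k => ?_, fun k => hd k (s k)⟩
  have hle : δ k ≤ D / 2 ^ k := (hδε k).trans (by gcongr; linarith)
  exact ⟨(s k).2.pos, fun i hi => ((s k).2.dist_lt i hi).trans_le hle, fun x =>
    (s k).2.dense x |>.imp fun i hi => ⟨hi.1, hi.2.trans_le hle⟩⟩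

/-- Parameters closer than `1 / N` have floor indices differing by at most one. -/
theorem IsDenseChain.dist_floor_le {δ : ℝ} {N : ℕ} {c : ℕ → X} (h : IsDenseChain δ N c) {s t : I}
    (hst : dist s t < 1 / N) : dist (c ⌊(s : ℝ) * N⌋₊) (c ⌊(t : ℝ) * N⌋₊) ≤ δ := by
  wlog hle : s ≤ t generalizing s t
  · rw [dist_comm]
    exact this (by rwa [dist_comm]) (le_of_not_ge hle)
  have hN : (0 : ℝ) < N := by exact_mod_cast h.pos
  have hδ : 0 ≤ δ := dist_nonneg.trans (h.dist_lt 0 h.pos).le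
  have hle' : (s : ℝ) ≤ t := hle
  have h1 : ⌊(s : ℝ) * N⌋₊ ≤ ⌊(t : ℝ) * N⌋₊ := Nat.floor_mono (by gcongr)
  have h2 : ⌊(t : ℝ) * N⌋₊ ≤ ⌊(s : ℝ) * N⌋₊ + 1 := by
    rw [← Nat.floor_add_one (mul_nonneg s.2.1 hN.le)]
    apply Nat.floor_mono
    rw [Subtype.dist_eq, dist_comm, Real.dist_eq, lt_div_iff₀ hN] at hst
    nlinarith [le_abs_self ((t : ℝ) - s)]
  have h3 : ⌊(t : ℝ) * N⌋₊ ≤ N := Nat.floor_le_of_le (by nlinarith [t.2.2])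
  rcases h1.eq_or_lt with h4 | h4
  · rw [h4, dist_self]
    exact hδ
  · obtain h5 : ⌊(t : ℝ) * N⌋₊ = ⌊(s : ℝ) * N⌋₊ + 1 := by omega
    rw [h5]
    exact (h.dist_lt _ (by omega)).le

/-- **Hahn–Mazurkiewicz theorem**: a compact, connected, locally connected metric space is a
continuous image of the unit interval. -/
theorem exists_unitInterval_continuous_surjective (X : Type*) [MetricSpace X] [CompactSpace X]
    [ConnectedSpace X] [LocallyConnectedSpace X] :
    ∃ f : I → X, Continuous f ∧ Function.Surjective f := by
  obtain ⟨D, N, M, c, hM, hN, hc, hd⟩ := exists_seq_isDenseChain (X := X)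
  have hNpos : ∀ k, (0 : ℝ) < N k := fun k => by exact_mod_cast (hc k).pos
  let F : ℕ → I → X := fun k t => c k ⌊(t : ℝ) * N k⌋₊
  have hF : ∀ t k, dist (F k t) (F (k + 1) t) ≤ D / 2 / 2 ^ k := by
    intro t k
    -- As `N (k + 1) = N k * M k`, the level-`k` index is the fine index divided by `M k`.
    have h1 : ⌊(t : ℝ) * N k⌋₊ = ⌊(t : ℝ) * N (k + 1)⌋₊ / M k := by
      rw [hN, Nat.cast_mul, ← mul_assoc, Nat.mul_cast_floor_div_cancel (hM k).ne']
    have h2 := hd k ⌊(t : ℝ) * N (k + 1)⌋₊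
      (Nat.floor_le_of_le (by nlinarith [t.2.2, hNpos (k + 1)]))
    rwa [← h1] at h2
  choose f hf using fun t => cauchySeq_tendsto_of_complete (cauchySeq_of_le_geometric_two (hF t))
  have hFf : ∀ t k, dist (F k t) (f t) ≤ D / 2 ^ k := fun t k =>
    dist_le_of_le_geometric_two_of_tendsto (hF t) (hf t) k
  -- Factor 3: two approximation errors plus one jump of the step function `F k`.
  have hsmall : ∀ ε > 0, ∃ k : ℕ, 3 * (D / 2 ^ k) < ε := by
    intro ε hε
    have h : Tendsto (fun k : ℕ => 3 * (D / 2 ^ k)) atTop (𝓝 (3 * 0)) :=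
      (tendsto_const_nhds.div_atTop (tendsto_pow_atTop_atTop_of_one_lt one_lt_two)).const_mul 3
    rw [mul_zero] at h
    exact (h.eventually (gt_mem_nhds hε)).exists
  have hcont : Continuous f := by
    rw [Metric.continuous_iff]
    intro t ε hε
    obtain ⟨k, hk⟩ := hsmall ε hε
    refine ⟨1 / N k, by simpa using hNpos k, fun s hs => ?_⟩
    have h1 : dist (F k s) (F k t) ≤ D / 2 ^ k := (hc k).dist_floor_le hs
    have h2 := dist_triangle4 (f s) (F k s) (F k t) (f t)
    linarith [dist_comm (f s) (F k s), hFf s k, hFf t k]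
  refine ⟨f, hcont, fun x => ?_⟩
  -- The range is closed, so surjectivity reduces to density, which the chains provide.
  have hclosed : IsClosed (Set.range f) := (isCompact_range hcont).isClosed
  change x ∈ Set.range f
  rw [← hclosed.closure_eq, Metric.mem_closure_range_iff]
  intro ε hε
  obtain ⟨k, hk⟩ := hsmall ε hε
  obtain ⟨i, hi, hx⟩ := (hc k).dense x
  have hi' : (i : ℝ) ≤ N k := by exact_mod_cast hi.le
  let t : I := ⟨(i : ℝ) / N k, by positivity, (div_le_one (hNpos k)).2 hi'⟩
  have ht : F k t = c k i := by
    simp only [F, t, div_mul_cancel₀ _ (hNpos k).ne', Nat.floor_natCast]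
  refine ⟨t, ?_⟩
  have h1 := hFf t k
  rw [ht] at h1
  have h2 := dist_triangle x (c k i) (f t)
  linarith [dist_nonneg (x := c k i) (y := f t)]

end Chains

/-! ### Borel sections and closed subsets of the interval. -/

namespace MomentTransform

/-- The section picks the least point of each compact fibre; its sublevel sets are then images of
the compact sets `C ∩ [0, a]`, hence closed. -/
theorem exists_measurable_section {C : Set I} (hC : IsClosed C) {X : Type*} [TopologicalSpace X]
    [T2Space X] [MeasurableSpace X] [BorelSpace X] {φ : C → X} (hφ : Continuous φ)
    (hsurj : Function.Surjective φ) : ∃ s : X → C, Measurable s ∧ ∀ x, φ (s x) = x := by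
  have : CompactSpace C := isCompact_iff_compactSpace.1 hC.isCompact
  have hleast : ∀ x, ∃ c, IsLeast (φ ⁻¹' {x}) c := fun x =>
    (isClosed_singleton.preimage hφ).isCompact.exists_isLeast (hsurj x)
  choose s hs using hleast
  have hφs : ∀ x, φ (s x) = x := fun x => (hs x).1
  refine ⟨s, ?_, hφs⟩
  have hmeas : Measurable fun x => (s x : I) := by
    refine measurable_of_Iic fun a => ?_
    have himage : (fun x => (s x : I)) ⁻¹' Set.Iic a = φ '' {c | (c : I) ≤ a} := by
      ext x
      constructor
      · exact fun h => ⟨s x, h, hφs x⟩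
      · rintro ⟨c, hc, rfl⟩
        exact le_trans (show (s (φ c) : I) ≤ c from (hs (φ c)).2 rfl) hc
    rw [himage]
    have hclosed : IsClosed {c : C | (c : I) ≤ a} := isClosed_Iic.preimage continuous_subtype_val
    exact (hclosed.isCompact.image hφ).isClosed.measurableSet
  exact hmeas.subtype_mk (h := fun x => (s x).2)

/-- A compact metric space is the continuous image of a closed subset of the unit interval. -/
theorem exists_isClosed_continuous_surjective (X : Type*) [Nonempty X] [MetricSpace X]
    [CompactSpace X] :
    ∃ (C : Set I) (φ : C → X), IsClosed C ∧ Continuous φ ∧ Function.Surjective φ := by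
  obtain ⟨f, hf, hfs⟩ := exists_nat_bool_continuous_surjective_of_compact X
  let j : ((Subtype.val : I → ℝ) ⁻¹' cantorSet) → cantorSet := fun t => ⟨t.1.1, t.2⟩
  have hj : Continuous j := by fun_prop
  have hjs : Function.Surjective j := fun c =>
    ⟨⟨⟨c.1, cantorSet_subset_unitInterval c.2⟩, c.2⟩, rfl⟩
  exact ⟨_, f ∘ cantorSetHomeomorphNatToBool ∘ j,
    isClosed_cantorSet.preimage continuous_subtype_val,
    hf.comp (cantorSetHomeomorphNatToBool.continuous.comp hj),
    hfs.comp (cantorSetHomeomorphNatToBool.surjective.comp hjs)⟩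

/-! ### Polynomial approximation and limits of integrals. -/

theorem exists_tendstoUniformly_polynomial (q : C(I, ℝ)) :
    ∃ p : ℕ → ℝ[X], TendstoUniformly (fun i (t : I) => (p i).eval (t : ℝ)) (fun t => q t) atTop := by
  choose p hp using fun i : ℕ =>
    exists_polynomial_near_continuousMap 0 1 q (1 / ((i : ℝ) + 1)) Nat.one_div_pos_of_nat
  refine ⟨p, Metric.tendstoUniformly_iff.2 fun ε hε => ?_⟩
  filter_upwards [(tendsto_one_div_add_atTop_nhds_zero_nat (𝕜 := ℝ)).eventually (gt_mem_nhds hε)]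
    with i hi t
  have h := (ContinuousMap.norm_coe_le_norm ((p i).toContinuousMapOn _ - q) t).trans_lt (hp i)
  rw [dist_comm, Real.dist_eq]
  exact lt_trans h hi

/-- Uniform convergence passes to integrals against a finite measure. -/
theorem tendsto_integral_of_tendstoUniformly {Y : Type*} [MeasurableSpace Y] {μ : Measure Y}
    [IsFiniteMeasure μ] {F : ℕ → Y → ℝ} {f : Y → ℝ} (hF : ∀ i, Integrable (F i) μ)
    (hf : Integrable f μ) (h : TendstoUniformly F f atTop) :
    Tendsto (fun i => ∫ y, F i y ∂μ) atTop (𝓝 (∫ y, f y ∂μ)) := by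
  have hev : ∀ᶠ i in atTop, ∀ y, ‖F i y‖ ≤ ‖f y‖ + 1 := by
    filter_upwards [Metric.tendstoUniformly_iff.1 h 1 one_pos] with i hi y
    have h1 := hi y
    rw [dist_comm, dist_eq_norm] at h1
    linarith [norm_sub_norm_le (F i y) (f y)]
  refine tendsto_integral_filter_of_dominated_convergence (fun y => ‖f y‖ + 1)
    (.of_forall fun i => (hF i).aestronglyMeasurable) (hev.mono fun i hi => .of_forall hi)
    (hf.norm.add (integrable_const 1)) (.of_forall fun y => h.tendsto_at y)

/-! ### Transfer of representing measures between `X` and `[0,1]`. -/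

section

variable {X : Type*} {V : Submodule ℝ (X → ℝ)} {g : X → I} {L : V →ₗ[ℝ] ℝ}
  {Lbar : ↥(V ⊔ polySpace g) →ₗ[ℝ] ℝ}

theorem HausdorffRepresents.isFiniteMeasure {μ : Measure I} {T : ℝ[X] →ₗ[ℝ] ℝ}
    (h : HausdorffRepresents μ T) : IsFiniteMeasure μ := by
  have h1 := (h 1).1
  simp only [Polynomial.eval_one] at h1
  exact (integrable_const_iff_isFiniteMeasure one_ne_zero).1 h1

theorem Represents.isFiniteMeasure [MeasurableSpace X] {μ : Measure X} (h : Represents μ L)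
    (h1 : (1 : X → ℝ) ∈ V) : IsFiniteMeasure μ :=
  (integrable_const_iff_isFiniteMeasure (one_ne_zero (α := ℝ))).1 (h ⟨1, h1⟩).1

/-- The functional is determined on `C([0,1]) ∘ g` by any measure representing `pullback Lbar`. -/
theorem IsContinuousExtension.apply_eq_integral (hL : IsContinuousExtension g L Lbar)
    {μ : Measure I} (hμ : HausdorffRepresents μ (pullback Lbar)) (q : C(I, ℝ))
    (hq : (fun x => q (g x)) ∈ V) : L ⟨fun x => q (g x), hq⟩ = ∫ t, q t ∂μ := by
  have := hμ.isFiniteMeasure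
  obtain ⟨p, hp⟩ := exists_tendstoUniformly_polynomial q
  refine tendsto_nhds_unique (hL.tendsto p q hq hp) ?_
  have h := tendsto_integral_of_tendstoUniformly (μ := μ) (fun i => (hμ (p i)).1)
    (q.continuous.integrable_of_hasCompactSupport (.of_compactSpace _)) hp
  exact h.congr fun i => ((hμ (p i)).2).symm

/-- A measure representing `pullback Lbar` is concentrated on every closed set containing the
range of `g`. -/
theorem IsContinuousExtension.ae_mem (hL : IsContinuousExtension g L Lbar)
    {μ : Measure I} (hμ : HausdorffRepresents μ (pullback Lbar)) {C : Set I} (hC : IsClosed C)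
    (hne : C.Nonempty) (hg : ∀ x, g x ∈ C) : ∀ᵐ t ∂μ, t ∈ C := by
  have := hμ.isFiniteMeasure
  -- The distance to `C` is nonnegative and vanishes on the range of `g`, so its `μ`-integral is `L
  -- 0 = 0`.
  let q : C(I, ℝ) := ⟨fun t => Metric.infDist t C, Metric.continuous_infDist_pt C⟩
  have hq0 : (fun x => q (g x)) = 0 := funext fun x => Metric.infDist_zero_of_mem (hg x)
  have hq : (fun x => q (g x)) ∈ V := hq0 ▸ V.zero_mem
  have h := hL.apply_eq_integral hμ q hq
  have hz : (⟨fun x => q (g x), hq⟩ : V) = 0 := Subtype.ext hq0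
  rw [hz, map_zero, eq_comm, integral_eq_zero_iff_of_nonneg (f := fun t => q t)
    (fun t => Metric.infDist_nonneg)
    (q.continuous.integrable_of_hasCompactSupport (.of_compactSpace _))] at h
  filter_upwards [h] with t ht
  exact (hC.mem_iff_infDist_zero hne).2 ht

theorem Represents.exists_isContinuousExtension [MeasurableSpace X] (h1 : (1 : X → ℝ) ∈ V)
    (hg : Measurable g) {μ : Measure X} (hμ : Represents μ L) :
    ∃ Lbar : ↥(V ⊔ polySpace g) →ₗ[ℝ] ℝ,
      IsContinuousExtension g L Lbar ∧ HausdorffRepresents (μ.map g) (pullback Lbar) := by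
  have := hμ.isFiniteMeasure h1
  have hq : ∀ q : C(I, ℝ), Integrable (fun x => q (g x)) μ := fun q =>
    (integrable_map_measure q.continuous.measurable.aestronglyMeasurable hg.aemeasurable).1
      (q.continuous.integrable_of_hasCompactSupport (.of_compactSpace _))
  have hp : ∀ p : ℝ[X], Integrable (fun x => p.eval (g x : ℝ)) μ := fun p =>
    hq ⟨fun t => p.eval (t : ℝ), by fun_prop⟩
  have hint : ∀ w : ↥(V ⊔ polySpace g), Integrable (w : X → ℝ) μ := by
    rintro ⟨w, hw⟩
    obtain ⟨v, hv, _, ⟨p, rfl⟩, rfl⟩ := Submodule.mem_sup.1 hw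
    exact (hμ ⟨v, hv⟩).1.add (hp p)
  -- Integration is defined on the whole sum at once, so agreement on the overlap of `V` and `ℝ[g]`
  -- needs no check.
  refine ⟨{ toFun := fun w => ∫ x, (w : X → ℝ) x ∂μ
            map_add' := fun w w' => integral_add (hint w) (hint w')
            map_smul' := fun a w => integral_const_mul a _ }, ⟨fun v => (hμ v).2.symm, ?_⟩, ?_⟩
  · intro p q hqV hpq
    rw [(hμ ⟨_, hqV⟩).2]
    exact tendsto_integral_of_tendstoUniformly (fun i => hp (p i)) (hq q) (hpq.comp g)
  · intro p
    have hc : Continuous fun t : I => p.eval (t : ℝ) := by fun_prop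
    refine ⟨hc.integrable_of_hasCompactSupport (.of_compactSpace _), ?_⟩
    rw [integral_map hg.aemeasurable hc.measurable.aestronglyMeasurable]
    rfl

variable [TopologicalSpace X] [MeasurableSpace X] [BorelSpace X]

theorem IsContinuousExtension.represents_map (hV : ∀ v ∈ V, Continuous v)
    (hL : IsContinuousExtension g L Lbar) {μ : Measure I}
    (hμ : HausdorffRepresents μ (pullback Lbar)) {f : I → X} (hf : Continuous f)
    (hfg : ∀ x, f (g x) = x) : Represents (μ.map f) L := by
  have := hμ.isFiniteMeasure
  rintro ⟨v, hv⟩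
  have hvf : Continuous (v ∘ f) := (hV v hv).comp hf
  have hvm : AEStronglyMeasurable v (μ.map f) := (hV v hv).measurable.aestronglyMeasurable
  have hq0 : (fun x => (⟨v ∘ f, hvf⟩ : C(I, ℝ)) (g x)) = v := funext fun x => by simp [hfg]
  have h := hL.apply_eq_integral hμ ⟨v ∘ f, hvf⟩ (hq0.symm ▸ hv : _ ∈ V)
  refine ⟨(integrable_map_measure hvm hf.measurable.aemeasurable).2
    (hvf.integrable_of_hasCompactSupport (.of_compactSpace _)), ?_⟩
  rw [integral_map hf.measurable.aemeasurable hvm]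
  refine Eq.trans (congrArg L (Subtype.ext hq0.symm)) h

theorem IsContinuousExtension.represents_map_comap (hV : ∀ v ∈ V, Continuous v)
    (hL : IsContinuousExtension g L Lbar) {μ : Measure I}
    (hμ : HausdorffRepresents μ (pullback Lbar)) {C : Set I} (hC : IsClosed C)
    (hne : C.Nonempty) {φ : C → X} (hφ : Continuous φ) (hg : ∀ x, g x ∈ C)
    (hφg : ∀ x, φ ⟨g x, hg x⟩ = x) :
    Represents ((μ.comap Subtype.val).map φ) L := by
  have := hμ.isFiniteMeasure
  have : CompactSpace C := isCompact_iff_compactSpace.1 hC.isCompact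
  have hfin : IsFiniteMeasure (μ.comap (Subtype.val : C → I)) := by
    refine ⟨?_⟩
    rw [comap_subtype_coe_apply hC.measurableSet]
    exact measure_lt_top _ _
  rintro ⟨v, hv⟩
  have hvφ : Continuous (v ∘ φ) := (hV v hv).comp hφ
  have hvm : AEStronglyMeasurable v ((μ.comap Subtype.val).map φ) :=
    (hV v hv).measurable.aestronglyMeasurable
  -- Tietze extension; the choice of `q` off `C` is harmless because `μ` is concentrated on `C`.
  obtain ⟨q, hq⟩ := ContinuousMap.exists_restrict_eq hC ⟨v ∘ φ, hvφ⟩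
  have hqC : ∀ c : C, q c = v (φ c) := fun c => DFunLike.congr_fun hq c
  have hq0 : (fun x => q (g x)) = v := funext fun x => by rw [hqC ⟨g x, hg x⟩, hφg]
  have h := hL.apply_eq_integral hμ q (hq0 ▸ hv)
  refine ⟨(integrable_map_measure hvm hφ.measurable.aemeasurable).2
    (hvφ.integrable_of_hasCompactSupport (.of_compactSpace _)), ?_⟩
  rw [integral_map hφ.measurable.aemeasurable hvm]
  simp only [← hqC]
  rw [integral_subtype_comap hC.measurableSet (fun t => q t),
    Measure.restrict_eq_self_of_ae_mem (hL.ae_mem hμ hC hne hg)]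
  exact Eq.trans (congrArg L (Subtype.ext hq0.symm)) h

end

end MomentTransform

/-! ### The main theorem. -/

theorem theorem4p2 (n : ℕ) (K : Set (EuclideanSpace ℝ (Fin n)))
    (hK : IsCompact K) (hpath : IsPathConnected K) :
    ∃ g : K → unitInterval, Measurable g ∧
      -- the equivalence, for all spaces `V` with `1 ∈ V ⊆ C(K, ℝ)` and all linear `L : V → ℝ`
      (∀ (V : Submodule ℝ (K → ℝ)), (1 : K → ℝ) ∈ V → (∀ v ∈ V, Continuous v) →
        ∀ L : V →ₗ[ℝ] ℝ,
          (MomentTransform.IsMomentFunctional L ↔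
            ∃ Lbar : ↥(V ⊔ MomentTransform.polySpace g) →ₗ[ℝ] ℝ,
              MomentTransform.IsContinuousExtension g L Lbar ∧
              MomentTransform.IsHausdorffMomentFunctional (MomentTransform.pullback Lbar)) ∧
          -- each representing measure `μ` of `L` yields an extension represented by `μ ∘ g⁻¹`
          (∀ μ : MeasureTheory.Measure K, MomentTransform.Represents μ L →
            ∃ Lbar : ↥(V ⊔ MomentTransform.polySpace g) →ₗ[ℝ] ℝ,
              MomentTransform.IsContinuousExtension g L Lbar ∧
              MomentTransform.HausdorffRepresents (μ.map g)
                (MomentTransform.pullback Lbar))) ∧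
      -- if `K` is locally connected, `g` is a section of a fixed continuous surjection `f`
      (LocallyConnectedSpace K →
        ∃ f : unitInterval → K, Continuous f ∧ Function.Surjective f ∧ (∀ x, f (g x) = x) ∧
          ∀ (V : Submodule ℝ (K → ℝ)), (1 : K → ℝ) ∈ V → (∀ v ∈ V, Continuous v) →
            ∀ (L : V →ₗ[ℝ] ℝ) (Lbar : ↥(V ⊔ MomentTransform.polySpace g) →ₗ[ℝ] ℝ),
              MomentTransform.IsContinuousExtension g L Lbar →
              ∀ μt : MeasureTheory.Measure unitInterval,
                MomentTransform.HausdorffRepresents μt (MomentTransform.pullback Lbar) →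
                MomentTransform.Represents (μt.map f) L) := by
  have : CompactSpace K := isCompact_iff_compactSpace.1 hK
  have : ConnectedSpace K := isConnected_iff_connectedSpace.1 hpath.isConnected
  -- One `g` must serve both parts, so its construction depends on whether `K` is locally connected.
  by_cases hloc : LocallyConnectedSpace K
  · obtain ⟨f, hf, hfs⟩ := exists_unitInterval_continuous_surjective K
    obtain ⟨s, hs, hfsec⟩ := MomentTransform.exists_measurable_section isClosed_univ
      (hf.comp continuous_subtype_val) (hfs.comp fun t => ⟨⟨t, trivial⟩, rfl⟩)
    have hg : Measurable fun x => (s x : unitInterval) := hs.subtype_val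
    refine ⟨fun x => s x, hg, fun V h1 hV L => ⟨⟨?_, ?_⟩, fun μ hμ =>
      hμ.exists_isContinuousExtension h1 hg⟩, fun _ => ⟨f, hf, hfs, hfsec,
        fun V _ hV L Lbar hL μt hμt => hL.represents_map hV hμt hf hfsec⟩⟩
    · rintro ⟨μ, hμ⟩
      obtain ⟨Lbar, hL, hrep⟩ := hμ.exists_isContinuousExtension h1 hg
      exact ⟨Lbar, hL, _, hrep⟩
    · rintro ⟨Lbar, hL, μt, hμt⟩
      exact ⟨_, hL.represents_map hV hμt hf hfsec⟩
  · obtain ⟨C, φ, hC, hφ, hφs⟩ := MomentTransform.exists_isClosed_continuous_surjective K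
    obtain ⟨s, hs, hsec⟩ := MomentTransform.exists_measurable_section hC hφ hφs
    have hg : Measurable fun x => (s x : unitInterval) := hs.subtype_val
    obtain ⟨x₀⟩ := (inferInstance : Nonempty K)
    refine ⟨fun x => s x, hg, fun V h1 hV L => ⟨⟨?_, ?_⟩, fun μ hμ =>
      hμ.exists_isContinuousExtension h1 hg⟩, fun h => absurd h hloc⟩
    · rintro ⟨μ, hμ⟩
      obtain ⟨Lbar, hL, hrep⟩ := hμ.exists_isContinuousExtension h1 hg
      exact ⟨Lbar, hL, _, hrep⟩
    · rintro ⟨Lbar, hL, μt, hμt⟩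
      exact ⟨_, hL.represents_map_comap hV hμt hC ⟨_, (s x₀).2⟩ hφ (fun x => (s x).2) hsec⟩
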